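/- Let $X$ be a $\sigma$-compact metric space with its Borel $\sigma$-algebra, let $\sigma$ be a $\sigma$-finite diffuse measure on $X$ (that is, $\sigma(\{x\})=0$ for all $x\in X$), and let $\Omega$ be the configuration space over $X$: the set of at most countable subsets $\omega\subset X$, each identified with the point measure $\omega(dy)=\sum_{x\in\omega}\delta_x(dy)$, with the $\sigma$-algebra generated by the maps $\omega\mapsto\omega(A)$, $A\subset X$ Borel with $\sigma(A)<\infty$. Let $\pi_\sigma$ be the Poisson measure on $\Omega$ with intensity $\sigma$: the probability measure under which $\omega(A)$ is Poisson distributed with parameter $\sigma(A)$ for every Borel $A$ with $\sigma(A)<\infty$, and $\omega(A_1),\ldots,\omega(A_m)$ are independent for all disjoint Borel sets $A_1,\ldots,A_m$ of finite $\sigma$-measure. Write $E$ for the expectation under $\pi_\sigma$. For $F:\Omega\to\mathbb R$ and $x_1,\ldots,x_k\in X$ put $\varepsilon^+_{x_1,\ldots,x_k}F(\omega)=F(\omega\cup\{x_1,\ldots,x_k\})$. Let $u_1,\ldots,u_p:X\times\Omega\to\mathbb R$ be measurable processes, $p\ge 1$, whose Poisson stochastic integrals $$\int_X u_i(x,\omega)\,\omega(dx)=\sum_{x\in\omega}u_i(x,\omega),\qquad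 i=1,\ldots,p,$$ exist, i.e. the sums converge absolutely for $\pi_\sigma$-almost every $\omega$. Let $n_1,\ldots,n_p\ge 0$ be integers with $n=n_1+\cdots+n_p\ge 1$. For a partition $\{P_1,\ldots,P_k\}$ of $\{1,\ldots,n\}$ into $k$ non-empty blocks put $$l_{i,j}=\bigl|P_j\cap(n_1+\cdots+n_{i-1},\,n_1+\cdots+n_i]\bigr|,\qquad i=1,\ldots,p,\ j=1,\ldots,k.$$ Assume that for every such partition the function $$(x_1,\ldots,x_k,\omega)\mapsto\varepsilon^+_{x_1,\ldots,x_k}\Bigl(\prod_{j=1}^k\prod_{i=1}^p u_i^{l_{i,j}}(x_j,\omega)\Bigr)$$ is integrable with respect to $\sigma^{\otimes k}\otimes\pi_\sigma$, where $\varepsilon^+_{x_1,\ldots,x_k}$ acts on the $\omega$-variable, with $x_1,\ldots,x_k$ fixed. Then $\prod_{i=1}^p\bigl(\int_X u_i(x,\omega)\,\omega(dx)\bigr)^{n_i}$ is $\pi_\sigma$-integrable and $$E\left[\prod_{i=1}^p\left(\int_X u_i(x,\omega)\,\omega(dx)\right)^{n_i}\right]=\sum_{k=1}^n\ \sum_{\{P_1,\ldots,P_k\}}E\left[\int_{X^k}\varepsilon^+_{x_1,\ldots,x_k}\Bigl(\prod_{j=1}^k\prod_{i=1}^p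 u_i^{l_{i,j}}(x_j,\omega)\Bigr)\sigma(dx_1)\cdots\sigma(dx_k)\right],$$ where the inner sum runs over all partitions of $\{1,\ldots,n\}$ into $k$ blocks. -/

import Mathlib

open MeasureTheory ProbabilityTheory

/-- The configuration space over `X`: the space of at most countable subsets of `X`. -/
structure Configuration (X : Type*) where
  /-- The set of points of the configuration. -/
  points : Set X
  countable_points : points.Countable

namespace Configuration

variable {X : Type*}

/-- The number `ω(A)` of points of `ω` in `A`, i.e. the mass that the point measure
`∑_{x ∈ ω} δ_x` gives to `A`. -/
noncomputable def count (A : Set X) (ω : Configuration X) : ℕ∞ := (ω.points ∩ A).encard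

/-- The σ-algebra on configurations generated by the counts `ω ↦ ω(A)`, `A` measurable.
By `measurableSpace_eq` below it is, for every σ-finite `σ`, the σ-algebra generated by the
counts `ω ↦ ω(A)` with `A` measurable and `σ(A) < ∞`. -/
noncomputable instance [MeasurableSpace X] : MeasurableSpace (Configuration X) :=
  ⨆ (A : Set X) (_ : MeasurableSet A), MeasurableSpace.comap (count A) ⊤

theorem measurableSpace_eq [MeasurableSpace X] (σ : Measure X) [SigmaFinite σ] :
    (inferInstance : MeasurableSpace (Configuration X)) =
      ⨆ (A : Set X) (_ : MeasurableSet A ∧ σ A < ⊤), MeasurableSpace.comap (count A) ⊤ := by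
  apply le_antisymm
  · refine iSup₂_le fun A hA => ?_
    rw [← measurable_iff_comap_le]
    set m : MeasurableSpace (Configuration X) :=
      ⨆ (A : Set X) (_ : MeasurableSet A ∧ σ A < ⊤), MeasurableSpace.comap (count A) ⊤
    have key : ∀ n, @Measurable _ _ m ⊤ (count (A ∩ spanningSets σ n)) := fun n => by
      rw [measurable_iff_comap_le]
      exact le_iSup₂_of_le (A ∩ spanningSets σ n)
        ⟨hA.inter (measurableSet_spanningSets σ n),
          (measure_mono Set.inter_subset_right).trans_lt (measure_spanningSets_lt_top σ n)⟩ le_rfl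
    have hmono : ∀ n ω, count (A ∩ spanningSets σ n) ω ≤ count A ω := fun n ω =>
      Set.encard_le_encard (Set.inter_subset_inter_right _ Set.inter_subset_left)
    have hge : ∀ (k : ℕ) (ω : Configuration X),
        (k : ℕ∞) ≤ count A ω ↔ ∃ n, (k : ℕ∞) ≤ count (A ∩ spanningSets σ n) ω := by
      intro k ω
      refine ⟨fun h => ?_, fun ⟨n, hn⟩ => hn.trans (hmono n ω)⟩
      obtain ⟨t, ht, htk⟩ := Set.exists_subset_encard_eq h
      have hfin : t.Finite := Set.finite_of_encard_eq_coe htk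
      obtain ⟨n, hn⟩ : ∃ n, t ⊆ spanningSets σ n := by
        choose f hf using fun x => Set.mem_iUnion.1 ((iUnion_spanningSets σ).ge (Set.mem_univ x))
        obtain ⟨N, hN⟩ := (hfin.image f).bddAbove
        exact ⟨N, fun x hx => monotone_spanningSets σ (hN (Set.mem_image_of_mem f hx)) (hf x)⟩
      exact ⟨n, htk ▸ Set.encard_le_encard fun x hx => ⟨(ht hx).1, (ht hx).2, hn hx⟩⟩
    have hset : ∀ k : ℕ, MeasurableSet[m] {ω : Configuration X | (k : ℕ∞) ≤ count A ω} := by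
      intro k
      simp only [hge, Set.ofPred_exists]
      exact MeasurableSet.iUnion fun n => key n (t := {c | (k : ℕ∞) ≤ c}) trivial
    refine @measurable_to_countable' _ _ _ _ m _ fun c => ?_
    induction c using ENat.recTopCoe with
    | top =>
      have : count A ⁻¹' {⊤} = ⋂ k : ℕ, {ω : Configuration X | (k : ℕ∞) ≤ count A ω} := by
        ext ω
        simp [ENat.eq_top_iff_forall_ge]
      rw [this]
      exact MeasurableSet.iInter hset
    | coe k =>
      have : count A ⁻¹' {(k : ℕ∞)} = {ω : Configuration X | (k : ℕ∞) ≤ count A ω} \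
          {ω : Configuration X | ((k + 1 : ℕ) : ℕ∞) ≤ count A ω} := by
        ext ω
        simp only [Set.mem_preimage, Set.mem_singleton_iff, Set.mem_sdiff, Set.mem_ofPred_eq]
        push_cast
        rw [ENat.add_one_le_iff (ENat.natCast_ne_top k), not_lt]
        exact ⟨fun h => ⟨h.ge, h.le⟩, fun h => le_antisymm h.2 h.1⟩
      rw [this]
      exact (hset k).diff (hset (k + 1))
  · exact iSup₂_le fun A hA => le_iSup₂_of_le A hA.1 le_rfl

/-- `ω ∪ {x_j : j}`: the configuration `ω` with finitely many points added. -/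
def addPoints {ι : Type*} [Finite ι] (ω : Configuration X) (x : ι → X) : Configuration X :=
  ⟨ω.points ∪ Set.range x, ω.countable_points.union (Set.finite_range x).countable⟩

end Configuration

/-- The addition operator `ε⁺_{x_1, …, x_k}`, acting on random variables by
`(ε⁺_{x_1, …, x_k} F)(ω) = F(ω ∪ {x_1, …, x_k})`. -/
def epsPlus {X ι : Type*} [Finite ι] (x : ι → X) (F : Configuration X → ℝ) :
    Configuration X → ℝ :=
  fun ω => F (ω.addPoints x)

/-- The Poisson stochastic integral `∫_X u(x, ω) ω(dx) = ∑_{x ∈ ω} u(x, ω)` of a process `u`;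
it is meant for absolutely convergent sums. -/
noncomputable def poissonIntegral {X : Type*} (u : X × Configuration X → ℝ)
    (ω : Configuration X) : ℝ :=
  ∑' x : ω.points, u (x, ω)

/-- `π` is the Poisson measure with intensity `σ`: the probability measure on configurations under
which `ω(A)` is Poisson distributed with parameter `σ(A)` whenever `σ(A) < ∞`, and
`ω(A_1), …, ω(A_m)` are independent for disjoint `A_1, …, A_m` of finite `σ`-measure. -/
structure IsPoissonMeasure {X : Type*} [MeasurableSpace X] (σ : Measure X)
    (π : Measure (Configuration X)) : Prop where
  isProbabilityMeasure : IsProbabilityMeasure π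
  map_count : ∀ A : Set X, MeasurableSet A → σ A < ⊤ →
    π.map (Configuration.count A) = (poissonMeasure (σ A).toNNReal).map ((↑) : ℕ → ℕ∞)
  iIndepFun_count : ∀ (m : ℕ) (A : Fin m → Set X), (∀ j, MeasurableSet (A j)) →
    (∀ j, σ (A j) < ⊤) → Pairwise (fun i j => Disjoint (A i) (A j)) →
    iIndepFun (fun j => Configuration.count (A j)) π

/-- For a block `B ⊆ {1, …, n_1 + ⋯ + n_p}`, the number
`|B ∩ (n_1 + ⋯ + n_{i-1}, n_1 + ⋯ + n_i]|` of its elements in the `i`-th interval. -/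
def blockPower {p : ℕ} (n : Fin p → ℕ) (i : Fin p) (B : Finset ℕ) : ℕ :=
  (B ∩ Finset.Ioc (∑ j ∈ Finset.Iio i, n j) (∑ j ∈ Finset.Iic i, n j)).card

/-- For a partition `P = {P_1, …, P_k}` of `{1, …, n_1 + ⋯ + n_p}`, with points `x_B` indexed by
the blocks `B` of `P`, the integrand
`ε⁺_{x_1, …, x_k} (∏_j ∏_i u_i^{l_{i,j}} (x_j, ω))`, where `l_{i,j} = blockPower n i P_j`. The
operator acts on the product as a function of the configuration, the points being fixed. -/
def partitionIntegrand {X : Type*} {p : ℕ} (u : Fin p → X × Configuration X → ℝ) (n : Fin p → ℕ)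
    (P : Finpartition (Finset.Icc 1 (∑ i, n i))) (x : P.parts → X) (ω : Configuration X) : ℝ :=
  epsPlus x (fun ω' => ∏ B : P.parts, ∏ i : Fin p, u i (x B, ω') ^ blockPower n i B) ω

/-!
The heart of the matter is the Mecke identity for several points: for `f ≥ 0` measurable,
`E ∑ f(ω, x_1, …, x_k)`, the sum being over distinct points `x_1, …, x_k` of `ω`, equals
`E ∫ f(ω ∪ {x_1, …, x_k}, x_1, …, x_k) σ(dx_1) ⋯ σ(dx_k)`
(`Configuration.lintegral_tsum_tuples`, and `Configuration.integral_tsum_tuples` for real `f`).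
Expanding the powers of the sums `∑_{x ∈ ω} u_i(x, ω)` gives a sum over all families of `n` points
of `ω` indexed by `{1, …, n}`; such a family is a partition of `{1, …, n}` together with distinct
points for its blocks (`sigmaPartsEmbeddingEquiv`), so the product of the integrals is almost
surely a finite sum over partitions of sums over distinct points
(`Configuration.prod_poissonIntegral_pow`), and the Mecke identity applies to each of these.

The identity for one point says that weighting `π` by `ω(B)` gives the image of `π ⊗ σ|_B` under
adding the point (`Configuration.countWeighted_eq_pointAdded`). Both measures are finite, and the
σ-algebra is generated by the counts, so it suffices to compare the joint laws of finitely many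
counts. After passing to the cells generated by the sets involved, the counts are independent
Poisson variables, and the claim becomes `c P(N = c) = r P(N + 1 = c)`, the identity that
characterizes the Poisson law (`poissonMeasure_map_shift`). Diffuseness enters since the added
point must not lie in `ω` already. Several points follow by induction.

Configurations are arbitrary countable sets, whose counts may be infinite, and on the space of all
of them the relation `x ∈ ω` need not be jointly measurable. Measurability questions are therefore
settled on the set `Configuration.locallyFinite σ`, which has full Poisson measure and is stable
under the addition of points: there the point measure of `ω` is an s-finite kernel
(`Configuration.pointKernel`).
-/

/-! ### The point measure of a locally finite configuration as a kernel -/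

namespace Configuration

variable {X : Type*} [MeasurableSpace X]

theorem measurable_count {A : Set X} (hA : MeasurableSet A) :
    Measurable (count A : Configuration X → ℕ∞) := by
  intro t _
  exact (le_iSup₂_of_le (f := fun (A : Set X) (_ : MeasurableSet A) =>
    MeasurableSpace.comap (count A) ⊤) A hA le_rfl) _ ⟨t, trivial, rfl⟩

/-- The configurations with finitely many points in each of the sets of finite measure exhausting
`X`. On all countable subsets of `X` the relation `x ∈ ω` is not jointly measurable; on this set of
full Poisson measure it is. -/
def locallyFinite (σ : Measure X) [SigmaFinite σ] : Set (Configuration X) :=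
  {ω | ∀ n, count (spanningSets σ n) ω ≠ ⊤}

variable (σ : Measure X) [SigmaFinite σ]

theorem measurableSet_locallyFinite : MeasurableSet (locallyFinite σ) := by
  have : locallyFinite σ = ⋂ n, count (spanningSets σ n) ⁻¹' {⊤}ᶜ := by
    ext ω; simp [locallyFinite]
  rw [this]
  exact MeasurableSet.iInter fun n =>
    measurable_count (measurableSet_spanningSets σ n) (MeasurableSet.of_discrete)

variable {σ} in
theorem addPoints_mem_locallyFinite {ι : Type*} [Finite ι] {ω : Configuration X}
    (hω : ω ∈ locallyFinite σ) (x : ι → X) : ω.addPoints x ∈ locallyFinite σ := by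
  intro n
  have h : (ω.points ∩ spanningSets σ n).Finite := Set.encard_ne_top_iff.1 (hω n)
  refine Set.encard_ne_top_iff.2 ((h.union (Set.finite_range x)).subset ?_)
  rintro y ⟨hy | hy, hn⟩
  exacts [Or.inl ⟨hy, hn⟩, Or.inr hy]

variable [MeasurableSingletonClass X]

theorem measurableSet_points (ω : Configuration X) : MeasurableSet ω.points :=
  ω.countable_points.measurableSet

open Classical in
/-- The kernel sending a locally finite configuration `ω` with `m` points in the `n`-th shell to the
restriction to this shell of the point measure `∑_{x ∈ ω} δ_x`, and all others to `0`. -/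
noncomputable def pointKernelPiece (n m : ℕ) : Kernel (Configuration X) X where
  toFun ω := if ω ∈ locallyFinite σ ∧ count (disjointed (spanningSets σ) n) ω = m then
    Measure.count.restrict (ω.points ∩ disjointed (spanningSets σ) n) else 0
  measurable' := by
    have hD : MeasurableSet (disjointed (spanningSets σ) n) :=
      MeasurableSet.disjointed (measurableSet_spanningSets σ) n
    refine Measure.measurable_of_measurable_coe _ fun A hA => ?_
    have : ∀ ω : Configuration X,
        (if ω ∈ locallyFinite σ ∧ count (disjointed (spanningSets σ) n) ω = m then
        Measure.count.restrict (ω.points ∩ disjointed (spanningSets σ) n) else 0 : Measure X) A =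
        if ω ∈ locallyFinite σ ∧ count (disjointed (spanningSets σ) n) ω = m then
          ((count (disjointed (spanningSets σ) n ∩ A) ω : ℕ∞) : ENNReal) else 0 := by
      intro ω
      split_ifs with h
      · rw [Measure.restrict_apply hA, Measure.count_apply
          (hA.inter (ω.measurableSet_points.inter hD)), count, Set.inter_comm A, Set.inter_assoc]
      · rfl
    simp_rw [this]
    refine Measurable.ite ((measurableSet_locallyFinite σ).inter
      (measurable_count hD (MeasurableSet.of_discrete (s := {(m : ℕ∞)})))) ?_ measurable_const
    exact (Measurable.of_discrete (f := ENat.toENNReal)).comp (measurable_count (hD.inter hA))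

open Classical in
instance (n m : ℕ) : IsFiniteKernel (pointKernelPiece σ n m) := by
  refine ⟨m, ENNReal.natCast_lt_top m, fun ω => ?_⟩
  change (if _ then _ else _ : Measure X) _ ≤ _
  split_ifs with h
  · have hD : MeasurableSet (disjointed (spanningSets σ) n) :=
      MeasurableSet.disjointed (measurableSet_spanningSets σ) n
    rw [Measure.restrict_apply_univ, Measure.count_apply (ω.measurableSet_points.inter hD)]
    have := h.2
    rw [count] at this
    rw [this]
    simp
  · simp

/-- The kernel sending a locally finite configuration to its point measure, and all others
to `0`. -/
noncomputable def pointKernel : Kernel (Configuration X) X :=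
  Kernel.sum fun q : ℕ × ℕ => pointKernelPiece σ q.1 q.2

instance : IsSFiniteKernel (pointKernel σ) := by
  unfold pointKernel; infer_instance

open Classical in
variable {σ} in
theorem pointKernel_eq {ω : Configuration X} (hω : ω ∈ locallyFinite σ) :
    pointKernel σ ω = Measure.count.restrict ω.points := by
  have hD : ∀ n, MeasurableSet (disjointed (spanningSets σ) n) :=
      MeasurableSet.disjointed (measurableSet_spanningSets σ)
  have h1 : ∀ n, Measure.sum (fun m => pointKernelPiece σ n m ω) =
      Measure.count.restrict (ω.points ∩ disjointed (spanningSets σ) n) := by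
    intro n
    have hfin : count (disjointed (spanningSets σ) n) ω ≠ ⊤ :=
      ne_top_of_le_ne_top (hω n) (Set.encard_le_encard
        (Set.inter_subset_inter_right _ (disjointed_subset _ n)))
    obtain ⟨k, hk⟩ := ENat.ne_top_iff_exists.1 hfin
    ext A hA
    rw [Measure.sum_apply _ hA, tsum_eq_single k]
    · change (if _ then _ else _ : Measure X) _ = _
      rw [if_pos ⟨hω, hk.symm⟩]
    · intro m hm
      change (if _ then _ else _ : Measure X) _ = _
      rw [if_neg]
      · rfl
      · rintro ⟨_, h⟩
        rw [← hk] at h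
        exact hm (by exact_mod_cast h.symm)
  rw [pointKernel, Kernel.sum_apply, ← Measure.sum_sum (fun n m => pointKernelPiece σ n m ω)]
  simp_rw [h1]
  rw [← Measure.restrict_iUnion, ← Set.inter_iUnion, iUnion_disjointed, iUnion_spanningSets,
    Set.inter_univ]
  · exact fun i j hij => (disjoint_disjointed _ hij).mono Set.inter_subset_right
      Set.inter_subset_right
  · exact fun n => ω.measurableSet_points.inter (hD n)

variable {σ} in
theorem lintegral_pointKernel {ω : Configuration X} (hω : ω ∈ locallyFinite σ)
    (f : X → ENNReal) : ∫⁻ x, f x ∂(pointKernel σ ω) = ∑' x : ω.points, f x := by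
  rw [pointKernel_eq hω, lintegral_countable _ ω.countable_points]
  simp

variable {σ} in
theorem pointKernel_apply {ω : Configuration X} (hω : ω ∈ locallyFinite σ) {B : Set X}
    (hB : MeasurableSet B) : pointKernel σ ω B = (count B ω : ENNReal) := by
  rw [pointKernel_eq hω, Measure.restrict_apply hB,
    Measure.count_apply (hB.inter ω.measurableSet_points), Set.inter_comm, count]

/-- Sums over the points of a locally finite configuration depend measurably on it and on
parameters. -/
theorem measurable_tsum_points {Y : Type*} [MeasurableSpace Y]
    {f : (Y × Configuration X) × X → ENNReal} (hf : Measurable f) :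
    Measurable fun z : Y × Configuration X =>
      (Prod.snd ⁻¹' locallyFinite σ).indicator (fun z => ∑' x : z.2.points, f (z, x)) z := by
  have h := (Measurable.lintegral_kernel_prod_right'
    (κ := (pointKernel σ).comap (Prod.snd : Y × Configuration X → _) measurable_snd) hf).indicator
      (measurable_snd (measurableSet_locallyFinite σ))
  convert h using 1
  ext z
  by_cases hz : z ∈ Prod.snd ⁻¹' locallyFinite σ
  · rw [Set.indicator_of_mem hz, Set.indicator_of_mem hz, Kernel.comap_apply,
      lintegral_pointKernel hz]
  · rw [Set.indicator_of_notMem hz, Set.indicator_of_notMem hz]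

end Configuration

/-! ### Measurability of the addition of points -/

namespace Configuration

variable {X : Type*}

theorem ext' {ω ω' : Configuration X} (h : ω.points = ω'.points) : ω = ω' := by
  cases ω; cases ω'; congr

theorem count_addPoint_of_mem {ω : Configuration X} {x : X} (A : Set X) (hx : x ∈ ω.points) :
    count A (ω.addPoints fun _ : Unit => x) = count A ω := by
  simp [count, addPoints, Set.insert_eq_of_mem hx]

open Classical in
theorem count_addPoint_of_notMem {ω : Configuration X} {x : X} (A : Set X) (hx : x ∉ ω.points) :
    count A (ω.addPoints fun _ : Unit => x) = count A ω + if x ∈ A then 1 else 0 := by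
  simp only [count, addPoints, Set.range_const, Set.union_singleton]
  split_ifs with h
  · rw [Set.insert_inter_of_mem h, Set.encard_insert_of_notMem fun h' => hx h'.1]
  · rw [Set.insert_inter_of_notMem h, add_zero]

variable [MeasurableSpace X]

theorem measurable_iff_count {Y : Type*} [MeasurableSpace Y] {f : Y → Configuration X} :
    Measurable f ↔ ∀ A : Set X, MeasurableSet A → Measurable fun y => count A (f y) := by
  refine ⟨fun h A hA => (measurable_count hA).comp h, fun h => ?_⟩
  rw [measurable_iff_comap_le]
  change MeasurableSpace.comap f (⨆ (A : Set X) (_ : MeasurableSet A),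
    MeasurableSpace.comap (count A) ⊤) ≤ _
  simp only [MeasurableSpace.comap_iSup, MeasurableSpace.comap_comp]
  exact iSup₂_le fun A hA => measurable_iff_comap_le.1 (h A hA)

variable (σ : Measure X) [SigmaFinite σ]

open Classical in
/-- Addition of finitely many points to a locally finite configuration; other configurations are
left unchanged, which makes the map measurable. -/
noncomputable def addTuple {ι : Type*} [Finite ι] (z : Configuration X × (ι → X)) :
    Configuration X :=
  if z.1 ∈ locallyFinite σ then z.1.addPoints z.2 else z.1

variable {σ} in
theorem addTuple_of_mem {ι : Type*} [Finite ι] {ω : Configuration X} (hω : ω ∈ locallyFinite σ)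
    (x : ι → X) : addTuple σ (ω, x) = ω.addPoints x := if_pos hω

variable {σ} in
theorem addTuple_of_notMem {ι : Type*} [Finite ι] {ω : Configuration X} (hω : ω ∉ locallyFinite σ)
    (x : ι → X) : addTuple σ (ω, x) = ω := if_neg hω

theorem addTuple_fin_zero (ω : Configuration X) (x : Fin 0 → X) : addTuple σ (ω, x) = ω := by
  by_cases hω : ω ∈ locallyFinite σ
  · rw [addTuple_of_mem hω]
    exact ext' (by simp [addPoints])
  · rw [addTuple_of_notMem hω]

theorem addTuple_addTuple_unit {k : ℕ} (ω : Configuration X) (y : X) (x : Fin k → X) :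
    addTuple σ (addTuple σ (ω, x), fun _ : Unit => y) =
      addTuple σ (ω, (Fin.cons y x : Fin (k + 1) → X)) := by
  by_cases hω : ω ∈ locallyFinite σ
  · rw [addTuple_of_mem hω, addTuple_of_mem hω, addTuple_of_mem (addPoints_mem_locallyFinite hω _)]
    refine ext' ?_
    simp only [addPoints, Fin.range_cons, Set.range_const, Set.union_singleton, Set.union_insert]
  · rw [addTuple_of_notMem hω, addTuple_of_notMem hω, addTuple_of_notMem hω]

variable [MeasurableEq X]

theorem measurableSet_mem_points :
    MeasurableSet {z : Configuration X × X | z.1 ∈ locallyFinite σ ∧ z.2 ∈ z.1.points} := by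
  have h := measurable_tsum_points σ (Y := X)
    (f := fun z : (X × Configuration X) × X => ({z | z.1.1 = z.2} : Set _).indicator 1 z)
    (measurable_one.indicator (measurableSet_eq_fun (by fun_prop) (by fun_prop)))
  convert (h.comp measurable_swap) (measurableSet_singleton 0).compl using 1
  ext ⟨ω, x⟩
  by_cases hω : ω ∈ locallyFinite σ
  · simp [hω]
  · simp [hω]

theorem measurable_addTuple_unit :
    Measurable fun z : Configuration X × X => addTuple σ (z.1, fun _ : Unit => z.2) := by
  classical
  refine measurable_iff_count.2 fun A hA => ?_
  let M : Set (Configuration X × X) := {z | z.1 ∈ locallyFinite σ ∧ z.2 ∈ z.1.points}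
  have hM : ∀ z, z ∈ M ↔ z.1 ∈ locallyFinite σ ∧ z.2 ∈ z.1.points := fun z => Iff.rfl
  have : (fun z : Configuration X × X => count A (addTuple σ (z.1, fun _ : Unit => z.2))) =
      fun z => if z ∈ M then
        count A z.1 else if z ∈ Prod.fst ⁻¹' locallyFinite σ then
        count A z.1 + (Prod.snd ⁻¹' A).indicator 1 z else count A z.1 := by
    ext1 z
    by_cases hω : z.1 ∈ locallyFinite σ
    · rw [addTuple_of_mem hω]
      by_cases hz : z.2 ∈ z.1.points
      · rw [count_addPoint_of_mem A hz, if_pos ((hM z).2 ⟨hω, hz⟩)]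
      · rw [count_addPoint_of_notMem A hz, if_neg fun h => hz ((hM z).1 h).2,
          if_pos (Set.mem_preimage.2 hω)]
        simp [Set.indicator_apply]
    · rw [addTuple_of_notMem hω, if_neg fun h => hω ((hM z).1 h).1,
        if_neg fun h => hω (Set.mem_preimage.1 h)]
  rw [this]
  have hc : Measurable fun z : Configuration X × X => count A z.1 :=
    (measurable_count hA).comp measurable_fst
  refine Measurable.ite (measurableSet_mem_points σ) hc (Measurable.ite
    (measurable_fst (measurableSet_locallyFinite σ)) (hc.add ?_) hc)
  exact measurable_one.indicator (measurable_snd hA)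

theorem measurable_addTuple_fin (k : ℕ) :
    Measurable (addTuple σ : Configuration X × (Fin k → X) → Configuration X) := by
  induction k with
  | zero =>
    convert measurable_fst (α := Configuration X) (β := Fin 0 → X) using 1
    exact funext fun z => addTuple_fin_zero σ z.1 z.2
  | succ k ih =>
    have : (addTuple σ : Configuration X × (Fin (k + 1) → X) → Configuration X) = fun z =>
        addTuple σ (addTuple σ (z.1, fun i : Fin k => z.2 i.succ), fun _ : Unit => z.2 0) := by
      ext1 ⟨ω, x⟩
      rw [addTuple_addTuple_unit]
      congr 2
      exact (Fin.cons_self_tail x).symm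
    rw [this]
    have h : Measurable fun z : Configuration X × (Fin (k + 1) → X) =>
        addTuple σ (z.1, fun i : Fin k => z.2 i.succ) :=
      ih.comp (f := fun z : Configuration X × (Fin (k + 1) → X) =>
        (z.1, fun i : Fin k => z.2 i.succ)) (by fun_prop)
    exact (measurable_addTuple_unit σ).comp
      (f := fun z : Configuration X × (Fin (k + 1) → X) =>
        (addTuple σ (z.1, fun i : Fin k => z.2 i.succ), z.2 0)) (h.prodMk (by fun_prop))

end Configuration

/-! ### Independent Poisson counts and the Mecke identity on cells -/

/-- The identity `c · P(N = c) = r · P(N + 1 = c)` characterizing the Poisson law, for a variable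
with values in `ℕ∞`. -/
theorem poissonMeasure_map_shift (r : NNReal) (c : ℕ∞) :
    (c : ENNReal) * ((poissonMeasure r).map ((↑) : ℕ → ℕ∞)) {c} =
      r * ((poissonMeasure r).map ((↑) : ℕ → ℕ∞)) {d | d + 1 = c} := by
  rw [Measure.map_apply Measurable.of_discrete MeasurableSet.of_discrete,
    Measure.map_apply Measurable.of_discrete MeasurableSet.of_discrete]
  induction c using ENat.recTopCoe with
  | top =>
    have h1 : ((↑) : ℕ → ℕ∞) ⁻¹' {⊤} = ∅ := by ext; simp
    simp [h1]
  | coe n =>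
    cases n with
    | zero => simp
    | succ n =>
      have h1 : ((↑) : ℕ → ℕ∞) ⁻¹' {((n + 1 : ℕ) : ℕ∞)} = {n + 1} := by
        ext; simp only [Set.mem_preimage, Set.mem_singleton_iff]; norm_cast
      have h2 : ((↑) : ℕ → ℕ∞) ⁻¹' {d | d + 1 = ((n + 1 : ℕ) : ℕ∞)} = {n} := by
        ext m
        simp only [Set.mem_preimage, Set.mem_singleton_iff, Set.mem_ofPred_eq]
        norm_cast
        omega
      rw [h1, h2, poissonMeasure_singleton, poissonMeasure_singleton,
        ← ENNReal.ofReal_coe_nnreal, ENat.toENNReal_coe, ← ENNReal.ofReal_natCast,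
        ← ENNReal.ofReal_mul (by positivity), ← ENNReal.ofReal_mul (by positivity)]
      congr 1
      rw [Nat.factorial_succ]
      push_cast
      field_simp
      ring

namespace Configuration

variable {X : Type*} [MeasurableSpace X] {σ : Measure X}
  {π : Measure (Configuration X)}

theorem _root_.IsPoissonMeasure.measure_inter {J : Type*} [Fintype J] (hπ : IsPoissonMeasure σ π)
    {C : J → Set X} (hC : ∀ j, MeasurableSet (C j)) (hC' : ∀ j, σ (C j) < ⊤)
    (hd : Pairwise fun i j => Disjoint (C i) (C j)) (T : J → Set ℕ∞) :
    π {ω | ∀ j, count (C j) ω ∈ T j} =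
      ∏ j, ((poissonMeasure (σ (C j)).toNNReal).map ((↑) : ℕ → ℕ∞)) (T j) := by
  let e := Fintype.equivFin J
  have hi : iIndepFun (fun j => count (C j)) π := by
    have h := (hπ.iIndepFun_count _ (fun m => C (e.symm m)) (fun _ => hC _) (fun _ => hC' _)
      fun i j hij => hd (e.symm.injective.ne hij)).precomp e.injective
    simpa [Function.comp_def] using h
  have := hi.measure_inter_preimage_eq_mul Finset.univ (sets := T)
    (fun _ _ => MeasurableSet.of_discrete)
  simp only [Finset.mem_univ, Set.iInter_true] at this
  have h2 : {ω | ∀ j, count (C j) ω ∈ T j} = ⋂ j, count (C j) ⁻¹' T j := by ext; simp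
  rw [h2, this]
  refine Finset.prod_congr rfl fun j _ => ?_
  rw [← Measure.map_apply (measurable_count (hC j)) MeasurableSet.of_discrete,
    hπ.map_count _ (hC j) (hC' j)]

variable [SigmaFinite σ]

theorem _root_.IsPoissonMeasure.ae_locallyFinite (hπ : IsPoissonMeasure σ π) :
    ∀ᵐ ω ∂π, ω ∈ locallyFinite σ := by
  refine ae_all_iff.2 fun n => ?_
  have h := hπ.map_count _ (measurableSet_spanningSets σ n) (measure_spanningSets_lt_top σ n)
  have h1 : π (count (spanningSets σ n) ⁻¹' {⊤}) = 0 := by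
    rw [← Measure.map_apply (measurable_count (measurableSet_spanningSets σ n))
      MeasurableSet.of_discrete, h,
      Measure.map_apply Measurable.of_discrete MeasurableSet.of_discrete]
    have h1 : ((↑) : ℕ → ℕ∞) ⁻¹' {⊤} = ∅ := by ext; simp
    simp [h1]
  exact measure_eq_zero_iff_ae_notMem.1 h1

variable [MeasurableEq X]

/-- A point chosen independently with the diffuse intensity is a.s. not in the configuration. -/
theorem ae_notMem_points [NullSingletonClass σ] (hπ : IsPoissonMeasure σ π) :
    ∀ᵐ z ∂(π.prod σ), z.1 ∈ locallyFinite σ ∧ z.2 ∉ z.1.points := by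
  have := hπ.isProbabilityMeasure
  have h1 : ∀ᵐ z ∂(π.prod σ), z.1 ∈ locallyFinite σ :=
    Measure.quasiMeasurePreserving_fst.ae hπ.ae_locallyFinite
  have h2 : ∀ᵐ z ∂(π.prod σ),
      z ∉ {z : Configuration X × X | z.1 ∈ locallyFinite σ ∧ z.2 ∈ z.1.points} := by
    rw [← measure_eq_zero_iff_ae_notMem, Measure.measure_prod_null (measurableSet_mem_points σ)]
    refine Filter.Eventually.of_forall fun ω => ?_
    exact measure_mono_null (t := ω.points) (fun x hx => hx.2)
      (ω.countable_points.measure_zero σ)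
  filter_upwards [h1, h2] with z h1 h2
  exact ⟨h1, fun h => h2 ⟨h1, h⟩⟩

variable (σ π) in
/-- The law under `π` of a configuration, weighted by its number of points in `B`. -/
noncomputable def countWeighted (B : Set X) : Measure (Configuration X) :=
  π.withDensity fun ω => (count B ω : ENNReal)

variable (σ π) in
/-- The image of the product of `π` and `σ|_B` under the addition of the point to the
configuration; its total mass is `σ(B)`. -/
noncomputable def pointAdded (B : Set X) : Measure (Configuration X) :=
  (π.prod (σ.restrict B)).map fun z => addTuple σ (z.1, fun _ : Unit => z.2)

theorem pointAdded_apply [SFinite π] {B : Set X} {G : Set (Configuration X)}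
    (hG : MeasurableSet G) :
    pointAdded σ π B G = ∫⁻ x in B, π {ω | addTuple σ (ω, fun _ : Unit => x) ∈ G} ∂σ := by
  rw [pointAdded, Measure.map_apply (measurable_addTuple_unit σ) hG,
    Measure.prod_apply_symm (measurable_addTuple_unit σ hG)]
  rfl

/-- The Mecke identity for the joint law of the counts in disjoint cells, one of which carries the
weight. -/
theorem map_countWeighted_cell (hπ : IsPoissonMeasure σ π) [NullSingletonClass σ]
    {J : Type*} [Fintype J]
    {C : J → Set X} (hC : ∀ j, MeasurableSet (C j)) (hC' : ∀ j, σ (C j) < ⊤)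
    (hd : Pairwise fun i j => Disjoint (C i) (C j)) (s : J) :
    (countWeighted π (C s)).map (fun ω j => count (C j) ω) =
      (pointAdded σ π (C s)).map (fun ω j => count (C j) ω) := by
  classical
  have := hπ.isProbabilityMeasure
  have hN : Measurable fun (ω : Configuration X) j => count (C j) ω :=
    measurable_pi_lambda _ fun j => measurable_count (hC j)
  refine Measure.ext_of_singleton fun c => ?_
  rw [Measure.map_apply hN (measurableSet_singleton c),
    Measure.map_apply hN (measurableSet_singleton c)]
  have hG := hN (measurableSet_singleton c)
  -- Both sides are products over the cells, equal factor by factor.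
  have hl : countWeighted π (C s) ((fun ω j => count (C j) ω) ⁻¹' {c}) =
      (c s : ENNReal) * π {ω | ∀ j, count (C j) ω ∈ ({c j} : Set ℕ∞)} := by
    rw [countWeighted, withDensity_apply _ hG]
    have h1 : (fun (ω : Configuration X) j => count (C j) ω) ⁻¹' {c} =
      {ω | ∀ j, count (C j) ω ∈ ({c j} : Set ℕ∞)} := by
      ext ω; simp [funext_iff]
    rw [setLIntegral_congr_fun (g := fun _ => (c s : ENNReal)) hG, setLIntegral_const, h1]
    intro ω hω
    have := congrFun hω s
    simp only at this
    simp only [this]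
  have hr : pointAdded σ π (C s) ((fun ω j => count (C j) ω) ⁻¹' {c}) =
      σ (C s) * π {ω | ∀ j, count (C j) ω ∈ {d | d + (if j = s then 1 else 0) = c j}} := by
    have h2 : ∀ᵐ x ∂(σ.restrict (C s)),
        π {ω | addTuple σ (ω, fun _ : Unit => x) ∈ (fun ω j => count (C j) ω) ⁻¹' {c}} =
        π {ω | ∀ j, count (C j) ω ∈ {d | d + (if j = s then 1 else 0) = c j}} := by
      have h3 := Measure.ae_ae_of_ae_prod (Measure.measurePreserving_swap
        (μ := σ) (ν := π).quasiMeasurePreserving.ae (ae_notMem_points hπ))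
      filter_upwards [ae_restrict_of_ae h3, ae_restrict_mem (hC s)] with x hx hxs
      refine measure_congr ?_
      filter_upwards [hx] with ω (hω : ω ∈ locallyFinite σ ∧ x ∉ ω.points)
      refine propext ?_
      change (fun j => count (C j) (addTuple σ (ω, fun _ : Unit => x))) = c ↔
        ∀ j, count (C j) ω + (if j = s then 1 else 0) = c j
      rw [addTuple_of_mem hω.1, funext_iff]
      refine forall_congr' fun j => ?_
      rw [count_addPoint_of_notMem _ hω.2]
      have : x ∈ C j ↔ j = s := ⟨fun h => by
        by_contra hj
        exact Set.disjoint_left.1 (hd hj) h hxs, fun h => h ▸ hxs⟩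
      simp only [this]
    rw [pointAdded_apply hG, lintegral_congr_ae h2, setLIntegral_const, mul_comm]
  rw [hl, hr, hπ.measure_inter hC hC' hd, hπ.measure_inter hC hC' hd,
    ← Finset.mul_prod_erase _ _ (Finset.mem_univ s), ← Finset.mul_prod_erase _ _
    (Finset.mem_univ s), ← mul_assoc, ← mul_assoc]
  congr 1
  · rw [poissonMeasure_map_shift, ENNReal.coe_toNNReal (hC' s).ne, if_pos rfl]
  · refine Finset.prod_congr rfl fun j hj => ?_
    simp [Finset.ne_of_mem_erase hj]

end Configuration

/-! ### The Mecke identity for sets -/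

namespace Configuration

variable {X : Type*}

theorem count_iUnion {J : Type*} [Fintype J] {C : J → Set X}
    (hd : Pairwise fun i j => Disjoint (C i) (C j)) (S : Finset J) (ω : Configuration X) :
    count (⋃ j ∈ S, C j) ω = ∑ j ∈ S, count (C j) ω := by
  classical
  simp only [count]
  induction S using Finset.induction_on with
  | empty => simp
  | insert a S ha ih =>
    rw [Finset.sum_insert ha, ← ih, Finset.set_biUnion_insert, Set.inter_union_distrib_left,
      Set.encard_union_eq]
    refine Disjoint.mono Set.inter_subset_right Set.inter_subset_right ?_
    rw [Set.disjoint_iUnion₂_right]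
    exact fun i hi => hd fun h => ha (h ▸ hi)

variable [MeasurableSpace X] {σ : Measure X} {π : Measure (Configuration X)}
  [MeasurableEq X] [SigmaFinite σ]

theorem isFiniteMeasure_countWeighted (hπ : IsPoissonMeasure σ π) [NullSingletonClass σ]
    {B : Set X} (hB : MeasurableSet B) (hB' : σ B < ⊤) :
    IsFiniteMeasure (countWeighted π B) ∧ countWeighted π B Set.univ = σ B := by
  have := hπ.isProbabilityMeasure
  have h := map_countWeighted_cell hπ (J := Unit) (C := fun _ => B) (fun _ => hB) (fun _ => hB')
    (fun i j h => absurd (Subsingleton.elim i j) h) ()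
  have h := congrArg (fun μ => μ Set.univ) h
  have hN : Measurable fun (ω : Configuration X) (_ : Unit) => count B ω :=
    measurable_pi_lambda _ fun j => measurable_count hB
  rw [Measure.map_apply hN .univ, Measure.map_apply hN .univ, Set.preimage_univ,
    pointAdded_apply .univ] at h
  simp at h
  exact ⟨⟨h ▸ hB'⟩, h⟩

theorem map_countWeighted_union (hπ : IsPoissonMeasure σ π) [NullSingletonClass σ]
    {J : Type*} [Fintype J]
    {C : J → Set X} (hC : ∀ j, MeasurableSet (C j)) (hC' : ∀ j, σ (C j) < ⊤)
    (hd : Pairwise fun i j => Disjoint (C i) (C j)) (S : Finset J) :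
    (countWeighted π (⋃ j ∈ S, C j)).map (fun ω j => count (C j) ω) =
      (pointAdded σ π (⋃ j ∈ S, C j)).map (fun ω j => count (C j) ω) := by
  have := hπ.isProbabilityMeasure
  have hN : Measurable fun (ω : Configuration X) j => count (C j) ω :=
    measurable_pi_lambda _ fun j => measurable_count (hC j)
  ext T hT
  have h : ∀ s, countWeighted π (C s) _ = pointAdded σ π (C s) _ := fun s => by
    have := congrArg (fun μ => μ T) (map_countWeighted_cell hπ hC hC' hd s)
    simpa only [Measure.map_apply hN hT] using this
  rw [Measure.map_apply hN hT, Measure.map_apply hN hT]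
  have hG := hN hT
  set G := (fun (ω : Configuration X) j => count (C j) ω) ⁻¹' T
  simp only [pointAdded_apply hG] at h ⊢
  rw [lintegral_biUnion_finset (fun i _ j _ hij => hd hij) (fun j _ => hC j)]
  simp only [← h, countWeighted, withDensity_apply _ hG]
  rw [← lintegral_finsetSum (f := fun j ω => (count (C j) ω : ENNReal)) _ fun j _ =>
    (Measurable.of_discrete (f := ENat.toENNReal)).comp (measurable_count (hC j))]
  refine lintegral_congr fun ω => ?_
  rw [count_iUnion hd]
  exact map_sum ENat.toENNRealRingHom _ _

/-- The Mecke identity for sets: weighting by the number of points in `B` amounts to adding a point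
of `B`. -/
theorem countWeighted_eq_pointAdded (hπ : IsPoissonMeasure σ π) [NullSingletonClass σ]
    {B : Set X} (hB : MeasurableSet B) (hB' : σ B < ⊤) :
    countWeighted π B = pointAdded σ π B := by
  classical
  have := (isFiniteMeasure_countWeighted hπ hB hB').1
  let K := {A : Set X // MeasurableSet A ∧ σ A < ⊤}
  let Φ : Configuration X → K → ℕ∞ := fun ω A => count A.1 ω
  have hΦ : Measurable Φ := measurable_pi_lambda _ fun A => measurable_count A.2.1
  -- The σ-algebra is generated by `Φ`, so finite-dimensional distributions have to be compared.
  have key : ∀ I : Finset K, ((countWeighted π B).map Φ).map I.restrict =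
      ((pointAdded σ π B).map Φ).map I.restrict := by
    intro I
    -- The cells are indexed by the sets among `B` and the members of `I` in which a point lies. The
    -- empty index is left out, since the complement of all these sets may have infinite measure.
    let I' := insert ⟨B, hB, hB'⟩ I
    let J := {s : Finset K // s ∈ I'.powerset ∧ s.Nonempty}
    let C : J → Set X := fun s => {x | ∀ A ∈ I', x ∈ A.1 ↔ A ∈ s.1}
    have : Finite J := Set.Finite.subset (s := (I'.powerset : Set (Finset K)))
      (Finset.finite_toSet _) (fun s hs => hs.1)
    have := Fintype.ofFinite J
    have hC : ∀ s, MeasurableSet (C s) := by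
      intro s
      have : C s = ⋂ A ∈ I', {x | x ∈ A.1 ↔ A ∈ s.1} := by ext; simp [C]
      rw [this]
      refine Finset.measurableSet_biInter _ fun A _ => ?_
      by_cases hA : A ∈ s.1
      · simpa [hA] using A.2.1
      · simp only [hA, iff_false]
        exact A.2.1.compl
    have hC' : ∀ s, σ (C s) < ⊤ := by
      rintro ⟨s, hs, A, hA⟩
      exact (measure_mono fun x hx => (hx A (Finset.mem_powerset.1 hs hA)).2 hA).trans_lt A.2.2
    have hd : Pairwise fun i j => Disjoint (C i) (C j) := by
      intro s t hst
      refine Set.disjoint_left.2 fun x hs ht => hst (Subtype.ext (Finset.ext fun A => ?_))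
      constructor
      · intro h
        have hA := Finset.mem_powerset.1 s.2.1 h
        exact (ht A hA).1 ((hs A hA).2 h)
      · intro h
        have hA := Finset.mem_powerset.1 t.2.1 h
        exact (hs A hA).1 ((ht A hA).2 h)
    have hA : ∀ A ∈ I', A.1 = ⋃ s ∈ Finset.univ.filter (fun s : J => A ∈ s.1), C s := by
      intro A hA
      ext x
      simp only [Set.mem_iUnion, Finset.mem_filter, Finset.mem_univ, true_and, exists_prop]
      constructor
      · intro hx
        refine ⟨⟨I'.filter (fun A => x ∈ A.1), by simp, A, by simp [hA, hx]⟩, by simp [hA, hx], ?_⟩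
        intro A' hA'
        simp [hA']
      · rintro ⟨s, hs, hx⟩
        exact (hx A hA).2 hs
    have hB0 := hA ⟨B, hB, hB'⟩ (Finset.mem_insert_self _ _)
    have h := map_countWeighted_union hπ hC hC' hd
      (Finset.univ.filter (fun s : J => ⟨B, hB, hB'⟩ ∈ s.1))
    rw [← hB0] at h
    have hN : Measurable fun (ω : Configuration X) j => count (C j) ω :=
      measurable_pi_lambda _ fun j => measurable_count (hC j)
    let g : (J → ℕ∞) → (I → ℕ∞) := fun c A => ∑ s with A.1 ∈ s.1, c s
    have hg : Measurable g := Measurable.of_discrete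
    have hcomp : I.restrict ∘ Φ = g ∘ fun ω j => count (C j) ω := by
      ext1 ω
      funext A
      change count A.1.1 ω = ∑ s with A.1 ∈ s.1, count (C s) ω
      rw [hA A.1 (Finset.mem_insert_of_mem A.2), count_iUnion hd]
    rw [Measure.map_map (Finset.measurable_restrict _) hΦ,
      Measure.map_map (Finset.measurable_restrict _) hΦ, hcomp, ← Measure.map_map hg hN, h,
      Measure.map_map hg hN]
  have hmap : (countWeighted π B).map Φ = (pointAdded σ π B).map Φ :=
    IsProjectiveLimit.unique (P := fun I => ((countWeighted π B).map Φ).map I.restrict)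
      (fun I => rfl) (fun I => (key I).symm)
  have hle : (inferInstance : MeasurableSpace (Configuration X)) ≤
      MeasurableSpace.comap Φ inferInstance := by
    rw [measurableSpace_eq σ]
    refine iSup₂_le fun A hA => ?_
    have : count A = (fun c : K → ℕ∞ => c ⟨A, hA⟩) ∘ Φ := rfl
    rw [this, ← MeasurableSpace.comap_comp]
    exact MeasurableSpace.comap_mono (measurable_pi_apply (⟨A, hA⟩ : K)).comap_le
  ext G hG
  obtain ⟨T, hT, rfl⟩ := hle G hG
  rw [← Measure.map_apply hΦ hT, hmap, Measure.map_apply hΦ hT]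

end Configuration

/-! ### The Mecke identity for functions of one and several points -/

namespace Configuration

universe v

variable {X : Type v}

/-- The families of distinct points of `ω` indexed by `ι`. -/
def tuples (ι : Type*) (ω : Configuration X) : Set (ι → X) :=
  {x | Function.Injective x ∧ ∀ i, x i ∈ ω.points}

theorem tsum_tuples_succ (k : ℕ) (ω : Configuration X) (F : (Fin (k + 1) → X) → ENNReal) :
    ∑' x : tuples (Fin (k + 1)) ω, F x = ∑' y : ω.points, ∑' x : tuples (Fin k) ω,
      {x : Fin k → X | y.1 ∉ Set.range x}.indicator (fun x => F (Fin.cons y.1 x)) x := by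
  rw [tsum_subtype (tuples (Fin (k + 1)) ω) F, ← (Fin.consEquiv fun _ => X).tsum_eq,
    ENNReal.summable.tsum_prod' fun _ => ENNReal.summable,
    tsum_subtype ω.points fun y => ∑' x : tuples (Fin k) ω,
      {x : Fin k → X | y ∉ Set.range x}.indicator (fun x => F (Fin.cons y x)) x]
  congr 1
  ext1 y
  by_cases hy : y ∈ ω.points
  · rw [Set.indicator_of_mem hy, tsum_subtype (tuples (Fin k) ω)
      ({x : Fin k → X | y ∉ Set.range x}.indicator (fun x => F (Fin.cons y x)))]
    congr 1
    ext1 x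
    rw [Set.indicator_indicator]
    have : (Fin.cons y x : Fin (k + 1) → X) ∈ tuples (Fin (k + 1)) ω ↔
        x ∈ tuples (Fin k) ω ∩ {x : Fin k → X | y ∉ Set.range x} := by
      simp only [tuples, Set.mem_ofPred_eq, Set.mem_inter_iff, Fin.cons_injective_iff,
        Fin.forall_fin_succ, Fin.cons_zero, Fin.cons_succ, hy, true_and]
      tauto
    by_cases h : (Fin.cons y x : Fin (k + 1) → X) ∈ tuples (Fin (k + 1)) ω
    · rw [Set.indicator_of_mem (this.1 h)]
      exact Set.indicator_of_mem h F
    · rw [Set.indicator_of_notMem fun h' => h (this.2 h')]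
      exact Set.indicator_of_notMem h F
  · rw [Set.indicator_of_notMem hy]
    refine ENNReal.tsum_eq_zero.2 fun x => Set.indicator_of_notMem (fun h => hy ?_) _
    exact h.2 0

/-- The families of distinct points of `ω ∪ {y}` avoiding `y ∉ ω` are those of `ω`. -/
theorem tsum_tuples_addPoint (k : ℕ) {ω : Configuration X} {y : X} (hy : y ∉ ω.points)
    (F : (Fin k → X) → ENNReal) :
    ∑' x : tuples (Fin k) (ω.addPoints fun _ : Unit => y),
      {x : Fin k → X | y ∉ Set.range x}.indicator F x = ∑' x : tuples (Fin k) ω, F x := by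
  rw [tsum_subtype _ ({x : Fin k → X | y ∉ Set.range x}.indicator F), tsum_subtype]
  congr 1
  ext1 x
  rw [Set.indicator_indicator]
  congr 1
  ext x
  simp only [tuples, addPoints, Set.mem_inter_iff, Set.mem_ofPred_eq, Set.range_const,
    Set.union_singleton, Set.mem_insert_iff, Set.mem_range, not_exists]
  constructor
  · rintro ⟨⟨h1, h2⟩, h3⟩
    exact ⟨h1, fun i => (h2 i).resolve_left (h3 i)⟩
  · rintro ⟨h1, h2⟩
    exact ⟨⟨h1, fun i => Or.inr (h2 i)⟩, fun i h => hy (h ▸ h2 i)⟩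

variable [MeasurableSpace X]

theorem measurable_cons (k : ℕ) :
    Measurable fun z : X × (Fin k → X) => (Fin.cons z.1 z.2 : Fin (k + 1) → X) :=
  measurable_pi_lambda _ fun i => by
    refine Fin.cases ?_ (fun j => ?_) i
    · simpa using measurable_fst
    · simp only [Fin.cons_succ]
      fun_prop

variable {σ : Measure X} {π : Measure (Configuration X)}
  [MeasurableEq X] [SigmaFinite σ]

/-- The one-point Mecke identity. -/
theorem lintegral_tsum_points (hπ : IsPoissonMeasure σ π) [NullSingletonClass σ]
    {f : Configuration X × X → ENNReal} (hf : Measurable f) :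
    ∫⁻ ω, ∑' x : ω.points, f (ω, x) ∂π =
      ∫⁻ z, f (addTuple σ (z.1, fun _ : Unit => z.2), z.2) ∂(π.prod σ) := by
  have := hπ.isProbabilityMeasure
  have hadd : Measurable fun z : Configuration X × X =>
      (addTuple σ (z.1, fun _ : Unit => z.2), z.2) :=
    (measurable_addTuple_unit σ).prodMk measurable_snd
  have hl : ∀ {G : Set (Configuration X)} {B : Set X}, MeasurableSet G → MeasurableSet B →
      (π ⊗ₘ pointKernel σ) (G ×ˢ B) = countWeighted π B G := by
    intro G B hG hB
    rw [Measure.compProd_apply_prod hG hB, countWeighted, withDensity_apply _ hG]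
    refine lintegral_congr_ae (ae_restrict_of_ae ?_)
    filter_upwards [hπ.ae_locallyFinite] with ω hω
    exact pointKernel_apply hω hB
  have hr : ∀ {G : Set (Configuration X)} {B : Set X}, MeasurableSet G → MeasurableSet B →
      ((π.prod σ).map fun z : Configuration X × X =>
        (addTuple σ (z.1, fun _ : Unit => z.2), z.2)) (G ×ˢ B) = pointAdded σ π B G := by
    intro G B hG hB
    rw [Measure.map_apply hadd (hG.prod hB), pointAdded, Measure.map_apply
      (measurable_addTuple_unit σ) hG, ← Measure.restrict_univ (μ := π), Measure.prod_restrict,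
      Measure.restrict_apply (measurable_addTuple_unit σ hG), Measure.restrict_univ]
    congr 1
    ext z
    simp
  have hμ : π ⊗ₘ pointKernel σ = (π.prod σ).map fun z : Configuration X × X =>
      (addTuple σ (z.1, fun _ : Unit => z.2), z.2) := by
    have hS := fun n => measurableSet_spanningSets σ n
    refine Measure.ext_of_iUnion_eq_univ
      (s := fun n => (Set.univ : Set (Configuration X)) ×ˢ spanningSets σ n) ?_ fun n => ?_
    · rw [← Set.prod_iUnion, iUnion_spanningSets, Set.univ_prod_univ]
    · have hfin : IsFiniteMeasure ((π ⊗ₘ pointKernel σ).restrict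
          (Set.univ ×ˢ spanningSets σ n)) := by
        refine ⟨?_⟩
        rw [Measure.restrict_apply_univ, hl .univ (hS n),
          (isFiniteMeasure_countWeighted hπ (hS n) (measure_spanningSets_lt_top σ n)).2]
        exact measure_spanningSets_lt_top σ n
      have hrect : ∀ {G : Set (Configuration X)} {B : Set X}, MeasurableSet G →
          MeasurableSet B → ((π ⊗ₘ pointKernel σ).restrict (Set.univ ×ˢ spanningSets σ n))
            (G ×ˢ B) = (((π.prod σ).map fun z : Configuration X × X =>
        (addTuple σ (z.1, fun _ : Unit => z.2), z.2)).restrict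
          (Set.univ ×ˢ spanningSets σ n)) (G ×ˢ B) := by
        intro G B hG hB
        rw [Measure.restrict_apply (hG.prod hB), Measure.restrict_apply (hG.prod hB),
          Set.prod_inter_prod, Set.inter_univ, hl hG (hB.inter (hS n)), hr hG (hB.inter (hS n)),
          countWeighted_eq_pointAdded hπ (hB.inter (hS n))
          ((measure_mono Set.inter_subset_right).trans_lt (measure_spanningSets_lt_top σ n))]
      exact Measure.ext_prod hrect
  rw [← lintegral_map hf hadd, ← hμ, Measure.lintegral_compProd hf]
  refine lintegral_congr_ae ?_
  filter_upwards [hπ.ae_locallyFinite] with ω hω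
  exact (lintegral_pointKernel hω fun x => f (ω, x)).symm

theorem measurableSet_notMem_range (k : ℕ) :
    MeasurableSet {z : X × (Fin k → X) | z.1 ∉ Set.range z.2} := by
  have : {z : X × (Fin k → X) | z.1 ∉ Set.range z.2} = ⋂ i, {z | z.2 i = z.1}ᶜ := by
    ext; simp
  rw [this]
  exact MeasurableSet.iInter fun i =>
    (measurableSet_eq_fun (by fun_prop) (by fun_prop)).compl

variable (σ) in
/-- Sums over families of distinct points of a locally finite configuration depend measurably on it
and on parameters. In the induction the first point of the family becomes a parameter. -/
theorem measurable_tsum_tuples (k : ℕ) {Y : Type v} [MeasurableSpace Y]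
    {f : (Y × Configuration X) × (Fin k → X) → ENNReal} (hf : Measurable f) :
    Measurable fun z : Y × Configuration X => (Prod.snd ⁻¹' locallyFinite σ).indicator
      (fun z => ∑' x : tuples (Fin k) z.2, f (z, x)) z := by
  induction k generalizing Y with
  | zero =>
    convert (hf.comp (g := f) (f := fun z => (z, Fin.elim0)) (by fun_prop)).indicator
      (measurable_snd (measurableSet_locallyFinite σ)) using 1
    ext1 z
    congr 1
    ext1 z
    have : tuples (Fin 0) z.2 = {Fin.elim0} := by
      ext x
      simp [tuples, Function.Injective, Subsingleton.elim x Fin.elim0]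
    rw [this]
    exact tsum_singleton Fin.elim0 fun x => f (z, x)
  | succ k ih =>
    have hg := ih (Y := Y × X) (f := fun z => {z : X × (Fin k → X) | z.1 ∉ Set.range z.2}.indicator
      (fun _ => f ((z.1.1.1, z.1.2), (Fin.cons z.1.1.2 z.2 : Fin (k + 1) → X)))
      (z.1.1.2, z.2)) ?_
    · have h := measurable_tsum_points σ (Y := Y) (hg.comp
        (f := fun z : (Y × Configuration X) × X => ((z.1.1, z.2), z.1.2)) (by fun_prop))
      convert h using 1
      ext1 z
      by_cases hz : z.2 ∈ locallyFinite σ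
      · have hz' : z ∈ (Prod.snd ⁻¹' locallyFinite σ : Set (Y × Configuration X)) := hz
        rw [Set.indicator_of_mem hz', Set.indicator_of_mem hz', tsum_tuples_succ k z.2
          fun x => f (z, x)]
        refine tsum_congr fun y => ?_
        have hm : (((z.1, y.1), z.2) : (Y × X) × Configuration X) ∈
          (Prod.snd ⁻¹' locallyFinite σ : Set ((Y × X) × Configuration X)) := hz
        simp only [Function.comp_apply]
        rw [Set.indicator_of_mem hm]
        rfl
      · have hz' : z ∉ (Prod.snd ⁻¹' locallyFinite σ : Set (Y × Configuration X)) := hz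
        rw [Set.indicator_of_notMem hz', Set.indicator_of_notMem hz']
    · have hcons := measurable_cons (X := X) k
      refine Measurable.indicator (s := (fun z : ((Y × X) × Configuration X) × (Fin k → X) =>
        (z.1.1.2, z.2)) ⁻¹' {z : X × (Fin k → X) | z.1 ∉ Set.range z.2}) (f := fun z =>
          f ((z.1.1.1, z.1.2), (Fin.cons z.1.1.2 z.2 : Fin (k + 1) → X))) (hf.comp ?_) ?_
      · exact Measurable.prodMk (by fun_prop) (hcons.comp
          (f := fun z : ((Y × X) × Configuration X) × (Fin k → X) => (z.1.1.2, z.2)) (by fun_prop))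
      · exact (measurableSet_notMem_range k).preimage (by fun_prop)

/-- The Mecke identity for several points. -/
theorem lintegral_tsum_tuples_fin (hπ : IsPoissonMeasure σ π) [NullSingletonClass σ] (k : ℕ)
    {f : Configuration X × (Fin k → X) → ENNReal} (hf : Measurable f) :
    ∫⁻ ω, ∑' x : tuples (Fin k) ω, f (ω, x) ∂π =
      ∫⁻ x, ∫⁻ ω, f (addTuple σ (ω, x), x) ∂π ∂(Measure.pi fun _ => σ) := by
  have := hπ.isProbabilityMeasure
  induction k with
  | zero =>
    have h0 : ∀ ω : Configuration X, tuples (Fin 0) ω = {Fin.elim0} := fun ω => by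
      ext x
      simp [tuples, Function.Injective, Subsingleton.elim x Fin.elim0]
    rw [Measure.pi_of_empty (fun _ : Fin 0 => σ) Fin.elim0, lintegral_dirac]
    refine lintegral_congr fun ω => ?_
    rw [h0, addTuple_fin_zero]
    exact tsum_singleton Fin.elim0 fun x => f (ω, x)
  | succ k ih =>
    have hcons : Measurable fun z : X × (Fin k → X) => (Fin.cons z.1 z.2 : Fin (k + 1) → X) :=
      measurable_cons k
    let g : Configuration X × X → ENNReal := fun z =>
      (Prod.snd ⁻¹' locallyFinite σ).indicator (fun z : X × Configuration X =>
        ∑' x : tuples (Fin k) z.2, {z : X × (Fin k → X) | z.1 ∉ Set.range z.2}.indicator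
          (fun x => f (z.2, (Fin.cons x.1 x.2 : Fin (k + 1) → X))) (z.1, x.1)) z.swap
    have hg_eq : ∀ {ω : Configuration X}, ω ∈ locallyFinite σ → ∀ y, g (ω, y) =
        ∑' x : tuples (Fin k) ω, {x : Fin k → X | y ∉ Set.range x}.indicator
          (fun x => f (ω, (Fin.cons y x : Fin (k + 1) → X))) x := fun {ω} hω y =>
      (Set.indicator_of_mem (show ((y, ω) : X × Configuration X) ∈
        Prod.snd ⁻¹' locallyFinite σ from hω) _).trans rfl
    have hg : Measurable g := by
      refine (measurable_tsum_tuples σ k (Y := X) (f := fun z =>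
        {z : X × (Fin k → X) | z.1 ∉ Set.range z.2}.indicator
          (fun x => f (z.1.2, (Fin.cons x.1 x.2 : Fin (k + 1) → X))) (z.1.1, z.2)) ?_).comp
        measurable_swap
      refine Measurable.indicator (s := (fun z : (X × Configuration X) × (Fin k → X) =>
        (z.1.1, z.2)) ⁻¹' {z : X × (Fin k → X) | z.1 ∉ Set.range z.2}) (f := fun z =>
          f (z.1.2, (Fin.cons z.1.1 z.2 : Fin (k + 1) → X))) (hf.comp ?_) ?_
      · exact Measurable.prodMk (by fun_prop) (hcons.comp
          (f := fun z : (X × Configuration X) × (Fin k → X) => (z.1.1, z.2)) (by fun_prop))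
      · exact (measurableSet_notMem_range k).preimage (by fun_prop)
    have hH : Measurable fun z : (Fin (k + 1) → X) × Configuration X =>
        f (addTuple σ (z.2, z.1), z.1) :=
      hf.comp (((measurable_addTuple_fin σ (k + 1)).comp measurable_swap).prodMk measurable_fst)
    calc ∫⁻ ω, ∑' x : tuples (Fin (k + 1)) ω, f (ω, x) ∂π
        = ∫⁻ ω, ∑' y : ω.points, g (ω, y) ∂π := by
          refine lintegral_congr_ae ?_
          filter_upwards [hπ.ae_locallyFinite] with ω hω
          rw [tsum_tuples_succ k ω fun x => f (ω, x)]
          refine tsum_congr fun y => ?_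
          exact (hg_eq hω y).symm
      _ = ∫⁻ z, g (addTuple σ (z.1, fun _ : Unit => z.2), z.2) ∂(π.prod σ) :=
          lintegral_tsum_points hπ hg
      _ = ∫⁻ y, ∫⁻ ω, g (addTuple σ (ω, fun _ : Unit => y), y) ∂π ∂σ :=
          lintegral_prod_symm' _ (hg.comp ((measurable_addTuple_unit σ).prodMk measurable_snd))
      _ = ∫⁻ y, ∫⁻ ω, ∑' x : tuples (Fin k) ω, f (addTuple σ (ω, fun _ : Unit => y),
            (Fin.cons y x.1 : Fin (k + 1) → X)) ∂π ∂σ := by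
          refine lintegral_congr_ae ?_
          filter_upwards [Measure.ae_ae_of_ae_prod (Measure.measurePreserving_swap
            (μ := σ) (ν := π).quasiMeasurePreserving.ae (ae_notMem_points hπ))] with y hy
          refine lintegral_congr_ae ?_
          filter_upwards [hy] with ω (hω : ω ∈ locallyFinite σ ∧ y ∉ ω.points)
          rw [addTuple_of_mem hω.1, hg_eq (addPoints_mem_locallyFinite hω.1 _),
            tsum_tuples_addPoint k hω.2]
      _ = ∫⁻ y, ∫⁻ x, ∫⁻ ω, f (addTuple σ (addTuple σ (ω, x), fun _ : Unit => y),
            (Fin.cons y x : Fin (k + 1) → X)) ∂π ∂(Measure.pi fun _ => σ) ∂σ := by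
          refine lintegral_congr fun y => ?_
          refine ih (f := fun z => f (addTuple σ (z.1, fun _ : Unit => y),
            (Fin.cons y z.2 : Fin (k + 1) → X))) (hf.comp (Measurable.prodMk ?_ ?_))
          · exact (measurable_addTuple_unit σ).comp (f := fun z : Configuration X × (Fin k → X) =>
              (z.1, y)) (by fun_prop)
          · exact hcons.comp (f := fun z : Configuration X × (Fin k → X) => (y, z.2)) (by fun_prop)
      _ = ∫⁻ y, ∫⁻ x, ∫⁻ ω, f (addTuple σ (ω, (Fin.cons y x : Fin (k + 1) → X)),
            (Fin.cons y x : Fin (k + 1) → X)) ∂π ∂(Measure.pi fun _ => σ) ∂σ := by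
          simp only [addTuple_addTuple_unit]
      _ = ∫⁻ z, ∫⁻ ω, f (addTuple σ (ω, (Fin.cons z.1 z.2 : Fin (k + 1) → X)),
            (Fin.cons z.1 z.2 : Fin (k + 1) → X)) ∂π ∂(σ.prod (Measure.pi fun _ => σ)) :=
          (lintegral_prod _ (hH.lintegral_prod_right'.comp hcons).aemeasurable).symm
      _ = ∫⁻ x, ∫⁻ ω, f (addTuple σ (ω, x), x) ∂π ∂(Measure.pi fun _ => σ) := by
          rw [← ((measurePreserving_piFinSuccAbove (fun _ : Fin (k + 1) => σ) 0).symm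
            _).lintegral_comp_emb (MeasurableEquiv.measurableEmbedding _)]
          have h : ∀ z, (MeasurableEquiv.piFinSuccAbove (fun _ => X) (0 : Fin (k + 1))).symm z =
              (Fin.cons z.1 z.2 : Fin (k + 1) → X) := fun z => by
            simp [MeasurableEquiv.piFinSuccAbove_symm_apply, Fin.insertNthEquiv]
          simp only [h]

end Configuration

/-! ### The Mecke identity for families with a general index set -/

namespace Configuration

variable {X : Type v}

theorem tsum_tuples_congr {ι κ M : Type*} [AddCommMonoid M] [TopologicalSpace M] (e : ι ≃ κ)
    (ω : Configuration X) (F : (ι → X) → M) :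
    ∑' x : tuples ι ω, F x = ∑' x : tuples κ ω, F (x.1 ∘ e) := by
  have h : ∀ x : κ → X,
      x ∈ tuples κ ω ↔ (Equiv.arrowCongr e (Equiv.refl X)).symm x ∈ tuples ι ω := by
    intro x
    have : (Equiv.arrowCongr e (Equiv.refl X)).symm x = x ∘ e := by ext; simp
    rw [this]
    simp only [tuples, Set.mem_ofPred_eq, Function.comp_apply, e.injective_comp]
    exact and_congr_right fun _ => ⟨fun h i => h _, fun h i => by simpa using h (e.symm i)⟩
  rw [← ((Equiv.arrowCongr e (Equiv.refl X)).symm.subtypeEquiv h).tsum_eq]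
  rfl

variable [MeasurableSpace X] {σ : Measure X} {π : Measure (Configuration X)}
  [MeasurableEq X] [SigmaFinite σ] {ι : Type*} [Fintype ι]

theorem aemeasurable_tsum_tuples (hπ : IsPoissonMeasure σ π)
    {f : Configuration X × (ι → X) → ENNReal} (hf : Measurable f) :
    AEMeasurable (fun ω => ∑' x : tuples ι ω, f (ω, x)) π := by
  let e := Fintype.equivFin ι
  have h := measurable_tsum_tuples σ (Fintype.card ι) (Y := PUnit)
    (f := fun z => f (z.1.2, z.2 ∘ e)) (hf.comp (by fun_prop))
  refine ⟨_, h.comp (measurable_const (a := PUnit.unit) |>.prodMk measurable_id), ?_⟩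
  filter_upwards [hπ.ae_locallyFinite] with ω hω
  rw [tsum_tuples_congr e ω fun x => f (ω, x)]
  have hm : (PUnit.unit, ω) ∈ (Prod.snd ⁻¹' locallyFinite σ : Set (PUnit × Configuration X)) := hω
  simp only [Function.comp_apply, id]
  rw [Set.indicator_of_mem hm]

/-- The Mecke identity for several points, for functions with values in `[0, ∞]`. -/
theorem lintegral_tsum_tuples (hπ : IsPoissonMeasure σ π) [NullSingletonClass σ]
    {f : Configuration X × (ι → X) → ENNReal} (hf : Measurable f) :
    ∫⁻ ω, ∑' x : tuples ι ω, f (ω, x) ∂π =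
      ∫⁻ x, ∫⁻ ω, f (ω.addPoints x, x) ∂π ∂(Measure.pi fun _ => σ) := by
  let e := Fintype.equivFin ι
  have hmp := measurePreserving_arrowCongr' (fun _ => σ) (fun _ => σ) e (MeasurableEquiv.refl X)
    (fun _ => MeasurePreserving.id σ)
  calc _ = ∫⁻ ω, ∑' x : tuples (Fin (Fintype.card ι)) ω, f (ω, x ∘ e) ∂π :=
        lintegral_congr fun ω => tsum_tuples_congr e ω fun x => f (ω, x)
    _ = ∫⁻ x : Fin (Fintype.card ι) → X, ∫⁻ ω, f (addTuple σ (ω, x), x ∘ e) ∂π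
          ∂(Measure.pi fun _ => σ) :=
        lintegral_tsum_tuples_fin hπ _ (f := fun z => f (z.1, z.2 ∘ e)) (hf.comp (by fun_prop))
    _ = ∫⁻ x : Fin (Fintype.card ι) → X, ∫⁻ ω, f (ω.addPoints (x ∘ e), x ∘ e) ∂π
          ∂(Measure.pi fun _ => σ) := by
        refine lintegral_congr fun x => lintegral_congr_ae ?_
        filter_upwards [hπ.ae_locallyFinite] with ω hω
        rw [addTuple_of_mem hω]
        congr 2
        exact ext' (by simp [addPoints, e.surjective.range_comp])
    _ = _ := by
        rw [← hmp.lintegral_comp_emb (MeasurableEquiv.measurableEmbedding _)]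
        have h : ∀ x : ι → X, (MeasurableEquiv.arrowCongr' e (MeasurableEquiv.refl X) x) ∘ e = x :=
          fun x => by ext i; simp [MeasurableEquiv.arrowCongr', Equiv.arrowCongr']
        simp only [h]

/-- The Mecke identity for several points, for real functions. -/
theorem integral_tsum_tuples (hπ : IsPoissonMeasure σ π) [NullSingletonClass σ]
    {G : Configuration X × (ι → X) → ℝ} (hG : Measurable G)
    (hint : Integrable (fun z : (ι → X) × Configuration X => G (z.2.addPoints z.1, z.1))
      ((Measure.pi fun _ => σ).prod π)) :
    (∀ᵐ ω ∂π, Summable fun x : tuples ι ω => G (ω, x)) ∧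
    Integrable (fun ω => ∑' x : tuples ι ω, G (ω, x)) π ∧
    ∫ ω, ∑' x : tuples ι ω, G (ω, x) ∂π =
      ∫ ω, ∫ x, G (ω.addPoints x, x) ∂(Measure.pi fun _ => σ) ∂π := by
  have := hπ.isProbabilityMeasure
  -- Positive and negative parts are treated alike.
  have key : ∀ {H : Configuration X × (ι → X) → ℝ}, Measurable H →
      Integrable (fun z : (ι → X) × Configuration X => H (z.2.addPoints z.1, z.1))
        ((Measure.pi fun _ => σ).prod π) →
      ∫⁻ ω, ∑' x : tuples ι ω, ENNReal.ofReal (H (ω, x)) ∂π =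
        ∫⁻ z, ENNReal.ofReal (H (z.2.addPoints z.1, z.1)) ∂((Measure.pi fun _ => σ).prod π) ∧
      ∫⁻ ω, ∑' x : tuples ι ω, ENNReal.ofReal (H (ω, x)) ∂π ≠ ⊤ := by
    intro H hH hi
    have h1 : ∫⁻ ω, ∑' x : tuples ι ω, ENNReal.ofReal (H (ω, x)) ∂π =
        ∫⁻ z, ENNReal.ofReal (H (z.2.addPoints z.1, z.1)) ∂((Measure.pi fun _ => σ).prod π) := by
      rw [lintegral_tsum_tuples hπ (f := fun z => ENNReal.ofReal (H z)) hH.ennreal_ofReal,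
        lintegral_prod _ hi.aemeasurable.ennreal_ofReal]
    exact ⟨h1, h1 ▸ hi.lintegral_lt_top.ne⟩
  obtain ⟨hp, hp'⟩ := key hG hint
  obtain ⟨hn, hn'⟩ := key (H := fun z => -G z) hG.neg hint.neg
  have mp := aemeasurable_tsum_tuples hπ (f := fun z => ENNReal.ofReal (G z)) hG.ennreal_ofReal
  have mn := aemeasurable_tsum_tuples hπ (f := fun z => ENNReal.ofReal (-G z))
    hG.neg.ennreal_ofReal
  have hsum : ∀ᵐ ω ∂π, HasSum (fun x : tuples ι ω => G (ω, x))
      ((∑' x : tuples ι ω, ENNReal.ofReal (G (ω, x))).toReal -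
        (∑' x : tuples ι ω, ENNReal.ofReal (-G (ω, x))).toReal) := by
    filter_upwards [ae_lt_top' mp hp', ae_lt_top' mn hn'] with ω h1 h2
    have h := (ENNReal.hasSum_toReal h1.ne).sub (ENNReal.hasSum_toReal h2.ne)
    simp only [ENNReal.toReal_ofReal', max_comm _ (0 : ℝ)] at h
    rw [ENNReal.tsum_toReal_eq fun _ => ENNReal.ofReal_ne_top,
      ENNReal.tsum_toReal_eq fun _ => ENNReal.ofReal_ne_top]
    simp only [ENNReal.toReal_ofReal', max_comm _ (0 : ℝ)]
    simpa only [max_comm (0 : ℝ), max_zero_sub_max_neg_zero_eq_self] using h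
  have hae : (fun ω => ∑' x : tuples ι ω, G (ω, x)) =ᵐ[π] fun ω =>
      (∑' x : tuples ι ω, ENNReal.ofReal (G (ω, x))).toReal -
        (∑' x : tuples ι ω, ENNReal.ofReal (-G (ω, x))).toReal := by
    filter_upwards [hsum] with ω h using h.tsum_eq
  have ip := integrable_toReal_of_lintegral_ne_top mp hp'
  have im := integrable_toReal_of_lintegral_ne_top mn hn'
  refine ⟨hsum.mono fun ω h => h.summable, (ip.sub im).congr hae.symm, ?_⟩
  rw [integral_congr_ae hae, integral_sub ip im, integral_toReal mp (ae_lt_top' mp hp'),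
    integral_toReal mn (ae_lt_top' mn hn'), hp, hn,
    ← integral_eq_lintegral_pos_part_sub_lintegral_neg_part hint]
  exact integral_prod_symm _ hint

end Configuration

/-! ### Products of series and partitions into level sets -/

theorem hasSum_prod_pi_fin {α : Type*} (n : ℕ) (f : Fin n → α → ℝ) (hf : ∀ i, Summable (f i)) :
    HasSum (fun x : Fin n → α => ∏ i, f i (x i)) (∏ i, ∑' a, f i a) := by
  induction n with
  | zero => simp
  | succ n ih =>
    have h := ih (fun i => f i.succ) fun i => hf i.succ
    have hs : Summable fun z : α × (Fin n → α) => f 0 z.1 * ∏ i : Fin n, f i.succ (z.2 i) :=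
      summable_mul_of_summable_norm (f := f 0)
        (g := fun x : Fin n → α => ∏ i : Fin n, f i.succ (x i))
        (hf 0).norm h.summable.norm
    have h0 := HasSum.mul (hf 0).hasSum h hs
    let e : α × (Fin n → α) ≃ (Fin (n + 1) → α) := Fin.consEquiv fun _ => α
    have hc : (fun x : Fin (n + 1) → α => ∏ i, f i (x i)) ∘ e =
        fun z : α × (Fin n → α) => f 0 z.1 * ∏ i : Fin n, f i.succ (z.2 i) := by
      funext z
      simp [e, Fin.prod_univ_succ]
    rw [Fin.prod_univ_succ, ← e.hasSum_iff, hc]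
    exact h0

/-- Expansion of a finite product of absolutely convergent series. -/
theorem hasSum_prod_pi {α ι : Type*} [Fintype ι] (f : ι → α → ℝ) (hf : ∀ i, Summable (f i)) :
    HasSum (fun x : ι → α => ∏ i, f i (x i)) (∏ i, ∑' a, f i a) := by
  let e := Fintype.equivFin ι
  have h := hasSum_prod_pi_fin _ (fun i => f (e.symm i)) fun i => hf _
  rw [e.symm.prod_comp fun i => ∑' a, f i a] at h
  rw [← (Equiv.arrowCongr e (Equiv.refl α)).symm.hasSum_iff]
  convert h using 2 with x
  rw [Function.comp_apply, ← e.symm.prod_comp]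
  simp

/-- A function on a finite set amounts to the partition of the set into its level sets, with
distinct values on the blocks. -/
noncomputable def sigmaPartsEmbeddingEquiv {α β : Type*} [DecidableEq α] (s : Finset α) :
    (Σ P : Finpartition s, (P.parts ↪ β)) ≃ (s → β) := by
  classical
  refine Equiv.ofBijective
    (fun Q a => Q.2 ⟨Q.1.part a.1, Q.1.part_mem.2 a.2⟩) ⟨?_, fun f => ?_⟩
  · rintro ⟨P, e⟩ ⟨Q, e'⟩ h
    have hfun : ∀ a (ha : a ∈ s), e ⟨P.part a, P.part_mem.2 ha⟩ = e' ⟨Q.part a, Q.part_mem.2 ha⟩ :=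
      fun a ha => congrFun h ⟨a, ha⟩
    have hpart : ∀ a ∈ s, P.part a = Q.part a := by
      intro a ha
      ext b
      by_cases hb : b ∈ s
      · rw [P.mem_part_iff_part_eq_part hb ha, Q.mem_part_iff_part_eq_part hb ha]
        have h1 : P.part b = P.part a ↔ e ⟨P.part b, P.part_mem.2 hb⟩ =
          e ⟨P.part a, P.part_mem.2 ha⟩ := by rw [e.injective.eq_iff, Subtype.mk.injEq]
        have h2 : Q.part b = Q.part a ↔ e' ⟨Q.part b, Q.part_mem.2 hb⟩ =
          e' ⟨Q.part a, Q.part_mem.2 ha⟩ := by rw [e'.injective.eq_iff, Subtype.mk.injEq]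
        rw [h1, h2, hfun a ha, hfun b hb]
      · exact ⟨fun h => absurd (P.part_subset a h) hb, fun h => absurd (Q.part_subset a h) hb⟩
    have hPQ : P = Q := by
      refine Finpartition.ext (Finset.ext fun B => ⟨fun hB => ?_, fun hB => ?_⟩)
      · obtain ⟨a, ha⟩ := P.nonempty_of_mem_parts hB
        have has := P.subset hB ha
        rw [← P.part_eq_of_mem hB ha, hpart a has]
        exact Q.part_mem.2 has
      · obtain ⟨a, ha⟩ := Q.nonempty_of_mem_parts hB
        have has := Q.subset hB ha
        rw [← Q.part_eq_of_mem hB ha, ← hpart a has]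
        exact P.part_mem.2 has
    subst hPQ
    have : e = e' := by
      ext ⟨B, hB⟩
      obtain ⟨a, ha⟩ := P.nonempty_of_mem_parts hB
      have h := hfun a (P.subset hB ha)
      simpa only [P.part_eq_of_mem hB ha] using h
    rw [this]
  -- Extended to all of `α`, the function `f` has a kernel that can be restricted to `s`.
  · let g : α → Option β := fun a => if h : a ∈ s then some (f ⟨a, h⟩) else none
    have hg : ∀ a b (ha : a ∈ s) (hb : b ∈ s), Setoid.ker g a b ↔ f ⟨a, ha⟩ = f ⟨b, hb⟩ := by
      intro a b ha hb
      simp [Setoid.ker_def, g, ha, hb]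
    let P := Finpartition.ofSetSetoid (Setoid.ker g) s
    choose c hc using fun B : P.parts => P.nonempty_of_mem_parts B.2
    have hcs : ∀ B, c B ∈ s := fun B => P.subset B.2 (hc B)
    refine ⟨⟨P, fun B => f ⟨c B, hcs B⟩, fun B B' h => ?_⟩, ?_⟩
    · have h1 : c B' ∈ P.part (c B) :=
        (Finpartition.mem_part_ofSetSetoid_iff_rel s).2 ⟨hcs B, hcs B', (hg _ _ _ _).2 h⟩
      rw [P.part_eq_of_mem B.2 (hc B)] at h1
      exact Subtype.ext (P.eq_of_mem_parts B.2 B'.2 h1 (hc B'))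
    · funext a
      have h1 := hc ⟨P.part a.1, P.part_mem.2 a.2⟩
      have h2 := (Finpartition.mem_part_ofSetSetoid_iff_rel s).1 h1
      exact ((hg _ _ a.2 h2.2.1).1 h2.2.2).symm

theorem sigmaPartsEmbeddingEquiv_apply {α β : Type*} [DecidableEq α] (s : Finset α)
    (Q : Σ P : Finpartition s, (P.parts ↪ β)) (a : s) :
    sigmaPartsEmbeddingEquiv s Q a = Q.2 ⟨Q.1.part a.1, Q.1.part_mem.2 a.2⟩ := rfl

/-! ### Expansion over partitions and the moment formula -/

/-- The `i`-th of the consecutive intervals of lengths `n_1, …, n_p`. -/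
def consecutiveInterval {p : ℕ} (n : Fin p → ℕ) (i : Fin p) : Finset ℕ :=
  Finset.Ioc (∑ j ∈ Finset.Iio i, n j) (∑ j ∈ Finset.Iic i, n j)

theorem sum_Iic_eq_sum_Iio_add {p : ℕ} (n : Fin p → ℕ) (i : Fin p) :
    ∑ j ∈ Finset.Iic i, n j = (∑ j ∈ Finset.Iio i, n j) + n i := by
  rw [← Finset.Iio_insert, Finset.sum_insert (by simp), add_comm]

theorem card_consecutiveInterval {p : ℕ} (n : Fin p → ℕ) (i : Fin p) :
    (consecutiveInterval n i).card = n i := by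
  rw [consecutiveInterval, sum_Iic_eq_sum_Iio_add, Nat.card_Ioc]
  omega

theorem pairwise_disjoint_consecutiveInterval {p : ℕ} (n : Fin p → ℕ) :
    Pairwise fun i j => Disjoint (consecutiveInterval n i) (consecutiveInterval n j) := by
  have key : ∀ i j, i < j → Disjoint (consecutiveInterval n i) (consecutiveInterval n j) := by
    intro i j hij
    refine Finset.disjoint_left.2 fun l hi hj => ?_
    have h : ∑ a ∈ Finset.Iic i, n a ≤ ∑ a ∈ Finset.Iio j, n a :=
      Finset.sum_le_sum_of_subset fun a ha =>
        Finset.mem_Iio.2 ((Finset.mem_Iic.1 ha).trans_lt hij)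
    have h1 := (Finset.mem_Ioc.1 hi).2
    have h2 := (Finset.mem_Ioc.1 hj).1
    omega
  intro i j hij
  rcases lt_or_gt_of_ne hij with h | h
  exacts [key i j h, (key j i h).symm]

theorem biUnion_consecutiveInterval {p : ℕ} (n : Fin p → ℕ) :
    Finset.univ.biUnion (consecutiveInterval n) = Finset.Icc 1 (∑ i, n i) := by
  refine Finset.eq_of_subset_of_card_le (fun l hl => ?_) ?_
  · obtain ⟨i, -, hi⟩ := Finset.mem_biUnion.1 hl
    have h : ∑ a ∈ Finset.Iic i, n a ≤ ∑ a, n a :=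
      Finset.sum_le_sum_of_subset (Finset.subset_univ _)
    have h1 := Finset.mem_Ioc.1 hi
    exact Finset.mem_Icc.2 ⟨by omega, by omega⟩
  · rw [Finset.card_biUnion fun i _ j _ hij => pairwise_disjoint_consecutiveInterval n hij]
    simp [card_consecutiveInterval]

/-- The index of the consecutive interval in which a number in `{1, …, n_1 + ⋯ + n_p}` lies. -/
theorem exists_intervalIndex {p : ℕ} (n : Fin p → ℕ) (hn : 1 ≤ ∑ i, n i) :
    ∃ c : ℕ → Fin p, ∀ l ∈ Finset.Icc 1 (∑ i, n i), ∀ i, c l = i ↔ l ∈ consecutiveInterval n i := by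
  have h : ∀ l ∈ Finset.Icc 1 (∑ i, n i), ∃ i, l ∈ consecutiveInterval n i := by
    intro l hl
    rw [← biUnion_consecutiveInterval n] at hl
    obtain ⟨i, -, hi⟩ := Finset.mem_biUnion.1 hl
    exact ⟨i, hi⟩
  have : Nonempty (Fin p) := ⟨(h 1 (Finset.mem_Icc.2 ⟨le_rfl, hn⟩)).choose⟩
  choose! c hc using h
  refine ⟨c, fun l hl i => ⟨fun h => h ▸ hc l hl, fun h => ?_⟩⟩
  by_contra hne
  exact Finset.disjoint_left.1 (pairwise_disjoint_consecutiveInterval n hne) (hc l hl) h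

theorem prod_pow_blockPower {p : ℕ} {n : Fin p → ℕ} {c : ℕ → Fin p}
    (hc : ∀ l ∈ Finset.Icc 1 (∑ i, n i), ∀ i, c l = i ↔ l ∈ consecutiveInterval n i)
    {B : Finset ℕ} (hB : B ⊆ Finset.Icc 1 (∑ i, n i)) (a : Fin p → ℝ) :
    ∏ i, a i ^ blockPower n i B = ∏ l ∈ B, a (c l) := by
  rw [← Finset.prod_fiberwise' B c a]
  refine Finset.prod_congr rfl fun i _ => ?_
  rw [Finset.prod_const, blockPower]
  congr 2
  ext l
  rw [Finset.mem_inter, Finset.mem_filter]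
  exact and_congr_right fun hl => (hc l (hB hl) i).symm

theorem blockPower_Icc {p : ℕ} (n : Fin p → ℕ) (i : Fin p) :
    blockPower n i (Finset.Icc 1 (∑ i, n i)) = n i := by
  rw [← card_consecutiveInterval n i, blockPower]
  congr 1
  refine Finset.inter_eq_right.2 ?_
  rw [← biUnion_consecutiveInterval]
  exact Finset.subset_biUnion_of_mem (consecutiveInterval n) (Finset.mem_univ i)

namespace Configuration

/-- Families of distinct points of `ω` are embeddings into `ω`. -/
def embeddingEquivTuples {X : Type*} (ι : Type*) (ω : Configuration X) :
    (ι ↪ ω.points) ≃ tuples ι ω where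
  toFun e := ⟨fun i => e i, Subtype.val_injective.comp e.injective, fun i => (e i).2⟩
  invFun x := ⟨fun i => ⟨x.1 i, x.2.2 i⟩, fun _ _ h => x.2.1 (congrArg Subtype.val h)⟩
  left_inv _ := rfl
  right_inv _ := rfl

/-- The product `∏_B ∏_i u_i^{l_{i,B}}(x_B, ω)` over the blocks `B` of a partition `P`. Evaluated at
`ω ∪ {x_B : B}` it is `partitionIntegrand`. -/
def partitionProduct {X : Type*} {p : ℕ} (u : Fin p → X × Configuration X → ℝ) (n : Fin p → ℕ)
    (P : Finpartition (Finset.Icc 1 (∑ i, n i))) (z : Configuration X × (P.parts → X)) : ℝ :=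
  ∏ B : P.parts, ∏ i : Fin p, u i (z.2 B, z.1) ^ blockPower n i B

/-- Expanding the powers and grouping the tuples of points by the partition of the indices on which
they coincide. -/
theorem prod_poissonIntegral_pow {X : Type*} {p : ℕ} {u : Fin p → X × Configuration X → ℝ}
    {n : Fin p → ℕ} (hn : 1 ≤ ∑ i, n i) {ω : Configuration X}
    (hu : ∀ i, Summable fun x : ω.points => u i (x, ω)) :
    ∏ i, poissonIntegral (u i) ω ^ n i =
      ∑ P : Finpartition (Finset.Icc 1 (∑ i, n i)),
        ∑' x : tuples P.parts ω, partitionProduct u n P (ω, x) := by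
  obtain ⟨c, hc⟩ := exists_intervalIndex n hn
  have h := hasSum_prod_pi (ι := Finset.Icc 1 (∑ i, n i))
    (fun l (x : ω.points) => u (c l) (x, ω)) fun l => hu _
  have hl : ∏ i, poissonIntegral (u i) ω ^ n i =
      ∏ l : Finset.Icc 1 (∑ i, n i), ∑' x : ω.points, u (c l) (x, ω) := by
    change _ = ∏ l : Finset.Icc 1 (∑ i, n i), poissonIntegral (u (c l)) ω
    rw [Finset.prod_coe_sort (Finset.Icc 1 (∑ i, n i)) fun l => poissonIntegral (u (c l)) ω,
      ← prod_pow_blockPower hc subset_rfl fun i => poissonIntegral (u i) ω]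
    simp only [blockPower_Icc]
  have h2 := (sigmaPartsEmbeddingEquiv (Finset.Icc 1 (∑ i, n i))).hasSum_iff.2 h
  have hterm : ∀ Q : Σ P : Finpartition (Finset.Icc 1 (∑ i, n i)), (P.parts ↪ ω.points),
      ∏ l : Finset.Icc 1 (∑ i, n i), u (c l) ((sigmaPartsEmbeddingEquiv _ Q l : ω.points), ω) =
        partitionProduct u n Q.1 (ω, embeddingEquivTuples _ ω Q.2) := by
    rintro ⟨P, e⟩
    let g : Finset.Icc 1 (∑ i, n i) → P.parts := fun l => ⟨P.part l.1, P.part_mem.2 l.2⟩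
    simp only [sigmaPartsEmbeddingEquiv_apply]
    rw [partitionProduct, ← Finset.prod_fiberwise _ g]
    refine Finset.prod_congr rfl fun B _ => ?_
    refine Eq.trans ?_ (prod_pow_blockPower hc (P.subset B.2) fun i => u i (e B, ω)).symm
    refine Finset.prod_bij (fun l _ => l.1) ?_ ?_ ?_ ?_
    · intro l hl
      rw [← (Finset.mem_filter.1 hl).2]
      exact P.mem_part_self.2 l.2
    · exact fun l _ l' _ h => Subtype.ext h
    · intro l hl
      exact ⟨⟨l, P.subset B.2 hl⟩, Finset.mem_filter.2 ⟨Finset.mem_univ _,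
        Subtype.ext (P.part_eq_of_mem B.2 hl)⟩, rfl⟩
    · intro l hl
      rw [← (Finset.mem_filter.1 hl).2]
  rw [hl, ← h2.tsum_eq, h2.summable.tsum_sigma, tsum_fintype]
  refine Finset.sum_congr rfl fun P _ => ?_
  rw [← (embeddingEquivTuples P.parts ω).tsum_eq]
  exact tsum_congr fun e => hterm ⟨P, e⟩

end Configuration

theorem proposition2p1 {X : Type*} [MetricSpace X] [SigmaCompactSpace X] [MeasurableSpace X]
    [BorelSpace X] (σ : Measure X) [SigmaFinite σ] [NullSingletonClass σ]
    (π : Measure (Configuration X)) (hπ : IsPoissonMeasure σ π)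
    (p : ℕ) (u : Fin p → X × Configuration X → ℝ) (hu : ∀ i, Measurable (u i))
    (hsum : ∀ i, ∀ᵐ ω ∂π, Summable fun x : ω.points => u i (x, ω))
    (n : Fin p → ℕ) (hn : 1 ≤ ∑ i, n i)
    (hint : ∀ P : Finpartition (Finset.Icc 1 (∑ i, n i)),
      Integrable (fun z : (P.parts → X) × Configuration X => partitionIntegrand u n P z.1 z.2)
        ((Measure.pi fun _ => σ).prod π)) :
    Integrable (fun ω => ∏ i, poissonIntegral (u i) ω ^ n i) π ∧
      ∫ ω, ∏ i, poissonIntegral (u i) ω ^ n i ∂π =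
        ∑ k ∈ Finset.Icc 1 (∑ i, n i),
          ∑ P : Finpartition (Finset.Icc 1 (∑ i, n i)) with P.parts.card = k,
            ∫ ω, ∫ x : P.parts → X, partitionIntegrand u n P x ω
              ∂(Measure.pi fun _ => σ) ∂π := by
  have : SecondCountableTopology X := UniformSpace.secondCountable_of_separable X
  have hm : ∀ P, Measurable (Configuration.partitionProduct u n P) := fun P =>
    Finset.measurable_prod _ fun B _ => Finset.measurable_prod _ fun i _ =>
      ((hu i).comp (by fun_prop)).pow_const _
  have hmecke := fun P => Configuration.integral_tsum_tuples hπ (hm P) (hint P)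
  have hae : (fun ω => ∏ i, poissonIntegral (u i) ω ^ n i) =ᵐ[π] fun ω =>
      ∑ P : Finpartition (Finset.Icc 1 (∑ i, n i)),
        ∑' x : Configuration.tuples P.parts ω, Configuration.partitionProduct u n P (ω, x) := by
    filter_upwards [ae_all_iff.2 hsum] with ω hω using
      Configuration.prod_poissonIntegral_pow hn hω
  refine ⟨(integrable_finsetSum _ fun P _ => (hmecke P).2.1).congr hae.symm, ?_⟩
  rw [integral_congr_ae hae, integral_finsetSum _ fun P _ => (hmecke P).2.1,
    Finset.sum_fiberwise_of_maps_to]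
  · exact Finset.sum_congr rfl fun P _ => (hmecke P).2.2
  · intro P _
    refine Finset.mem_Icc.2 ⟨Finset.card_pos.2 (P.parts_nonempty ?_), ?_⟩
    · exact Finset.nonempty_iff_ne_empty.1 ⟨1, Finset.mem_Icc.2 ⟨le_rfl, hn⟩⟩
    · simpa using P.card_parts_le_card
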